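/- Let $n,m\ge 2$ be integers and let $\mathcal H=\big((\mathbb C^m)^{\otimes n}\big)^{S_n}$ be the Hilbert space of $n$ photons in $m$ modes, i.e. the symmetric subspace of $(\mathbb C^m)^{\otimes n}$. Let $U(\mathcal H)$ be its unitary group, and let the group of linear optical unitaries $U_{n,m}\subseteq U(\mathcal H)$ be the image of the homomorphism $U(m)\to U(\mathcal H)$, $U\mapsto U^{\otimes n}|_{\mathcal H}$ (it is a closed subgroup). For $t\in\mathbb N$, a closed subgroup $G\subseteq U(\mathcal H)$ is called a (unitary) $t$-design if for every linear operator $X$ on $\mathcal H^{\otimes t}$ $$\int_G (U^\dagger)^{\otimes t}\,X\,U^{\otimes t}\,d\mu_G(U)=\int_{U(\mathcal H)} (U^\dagger)^{\otimes t}\,X\,U^{\otimes t}\,d\mu_{U(\mathcal H)}(U),$$ where $\mu_K$ denotes the normalized Haar measure of the compact group $K$. A set of unitaries is called universal if the closure of the group that it generates contains the special unitary group $SU(\mathcal H)$ (that is, the group is dense in $U(\mathcal H)$ up to global phases). Then: 1. If $G$ is a closed subgroup with $U_{n,m}\subseteq G\subseteq U(\mathcal H)$ and $G$ is a $2$-design,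 then $G$ is universal; moreover $G=U(\mathcal H)$. 2. $U_{n,m}$ is not universal. 3. Consequently, $U_{n,m}$ is not a $t$-design for any $t\ge 2$. -/

import Mathlib

open MeasureTheory Matrix
open scoped TensorProduct

noncomputable section

/-! ### Unitary groups of finite-dimensional Hilbert spaces, twirls and designs -/

section Designs

variable (V : Type*) [NormedAddCommGroup V] [InnerProductSpace ℂ V] [CompleteSpace V]

/-- The bounded operators on `V`. -/
abbrev OperatorOn : Type _ := V →L[ℂ] V

/-- The unitary group `U(V)` of a complex Hilbert space, with the operator norm topology. -/
abbrev UnitaryOn : Type _ := unitary (OperatorOn V)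

instance UnitaryOn.compactSpace [FiniteDimensional ℂ V] : CompactSpace (UnitaryOn V) := by
  have : ProperSpace (V →L[ℂ] V) := FiniteDimensional.proper ℂ _
  refine isCompact_iff_compactSpace.mp ?_
  refine (isCompact_closedBall (0 : V →L[ℂ] V) ‖(1 : V →L[ℂ] V)‖).of_isClosed_subset
    isClosed_unitary ?_
  intro T hT
  have h := CStarRing.norm_coe_unitary_mul (⟨T, hT⟩ : unitary (V →L[ℂ] V)) 1
  simp only [mul_one] at h
  simp [h]

instance (G : ClosedSubgroup (UnitaryOn V)) : IsTopologicalGroup G :=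
  inferInstanceAs (IsTopologicalGroup (G : Subgroup (UnitaryOn V)))

/-- The normalized Haar measure of a compact group. -/
def haarProb (K : Type*) [Group K] [TopologicalSpace K] [IsTopologicalGroup K] [CompactSpace K]
    [MeasurableSpace K] [BorelSpace K] : Measure K :=
  Measure.haarMeasure ⊤

variable {V}

/-- The operator `T ⊗ ⋯ ⊗ T` (`t` factors) on the `t`-fold tensor power of `V`. -/
def tensorPowMap (t : ℕ) (T : V →L[ℂ] V) :
    (⨂[ℂ] _ : Fin t, V) →ₗ[ℂ] (⨂[ℂ] _ : Fin t, V) :=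
  PiTensorProduct.map fun _ => (T : V →ₗ[ℂ] V)

/-- The `t`-fold twirl `Φ(X) = ∫ (U†)^{⊗ t} X U^{⊗ t} dμ(U)` of a measure `μ` on `U(V)`. The space
of operators on the tensor power being finite-dimensional, the operator-valued integral is given by
its values under all linear functionals `φ`. -/
def twirl (t : ℕ) (μ : Measure (UnitaryOn V)) (X : Module.End ℂ (⨂[ℂ] _ : Fin t, V))
    (φ : Module.Dual ℂ (Module.End ℂ (⨂[ℂ] _ : Fin t, V))) : ℂ :=
  ∫ U : UnitaryOn V,
    φ (tensorPowMap t (star (U : V →L[ℂ] V)) ∘ₗ X ∘ₗ tensorPowMap t (U : V →L[ℂ] V)) ∂μ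

/-- An ensemble (probability distribution) `μ` on `U(V)` is a unitary `t`-design if its `t`-fold
twirl is the same as that of the Haar measure of `U(V)`, on all operators. -/
def IsUnitaryDesign [FiniteDimensional ℂ V] (t : ℕ) (μ : Measure (UnitaryOn V)) : Prop :=
  ∀ X : Module.End ℂ (⨂[ℂ] _ : Fin t, V), twirl t μ X = twirl t (haarProb (UnitaryOn V)) X

/-- A closed subgroup `G` of `U(V)` is a unitary `t`-design if the ensemble of unitaries distributed
according to the normalized Haar measure of `G` is one. -/
def IsGroupDesign [FiniteDimensional ℂ V] (t : ℕ) (G : ClosedSubgroup (UnitaryOn V)) : Prop :=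
  IsUnitaryDesign t ((haarProb G).map ((↑) : G → UnitaryOn V))

/-- A set of unitaries is universal if the group that it generates is dense in `U(V)` up to global
phases, i.e. the closure of that group contains the special unitary group `SU(V)`. -/
def IsUniversal (S : Set (UnitaryOn V)) : Prop :=
  ∀ W : UnitaryOn V, LinearMap.det ((W : V →L[ℂ] V) : V →ₗ[ℂ] V) = 1 →
    W ∈ (Subgroup.closure S).topologicalClosure

end Designs

/-! ### Linear optics -/

/-- The space `(ℂ^m)^{⊗ n}`, through the coordinates with respect to its standard orthonormal basis
`v_{f 0} ⊗ ⋯ ⊗ v_{f (n-1)}`, `f : Fin n → Fin m`. -/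
abbrev PhotonTensor (n m : ℕ) : Type := EuclideanSpace ℂ (Fin n → Fin m)

/-- The Hilbert space of `n` photons in `m` modes: the vectors of `(ℂ^m)^{⊗ n}` that are invariant
under all permutations of the tensor factors. -/
def fockSpace (n m : ℕ) : Submodule ℂ (PhotonTensor n m) where
  carrier := {ψ | ∀ (σ : Equiv.Perm (Fin n)) (f : Fin n → Fin m), ψ (f ∘ σ) = ψ f}
  add_mem' := by
    intro a b ha hb σ f
    simp [ha σ f, hb σ f]
  zero_mem' := by
    intro σ f
    simp
  smul_mem' := by
    intro c a ha σ f
    simp [ha σ f]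

instance (n m : ℕ) : CompleteSpace (fockSpace n m) :=
  FiniteDimensional.complete ℂ _

/-- The matrix of `A^{⊗ n}` in the standard basis of `(ℂ^m)^{⊗ n}`. -/
def kroneckerPow (n : ℕ) {m : ℕ} (A : Matrix (Fin m) (Fin m) ℂ) :
    Matrix (Fin n → Fin m) (Fin n → Fin m) ℂ :=
  Matrix.of fun f g => ∏ i, A (f i) (g i)

theorem kroneckerPow_one (n m : ℕ) : kroneckerPow n (1 : Matrix (Fin m) (Fin m) ℂ) = 1 := by
  ext f g
  by_cases h : f = g
  · subst h
    simp [kroneckerPow]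
  · obtain ⟨i, hi⟩ := Function.ne_iff.mp h
    simp only [kroneckerPow, Matrix.of_apply, Matrix.one_apply_ne h]
    exact Finset.prod_eq_zero (Finset.mem_univ i) (Matrix.one_apply_ne hi)

theorem kroneckerPow_mul (n : ℕ) {m : ℕ} (A B : Matrix (Fin m) (Fin m) ℂ) :
    kroneckerPow n (A * B) = kroneckerPow n A * kroneckerPow n B := by
  ext f g
  simp only [kroneckerPow, Matrix.of_apply, Matrix.mul_apply, ← Finset.prod_mul_distrib]
  rw [Finset.prod_univ_sum]
  simp [Fintype.piFinset_univ]

theorem kroneckerPow_conjTranspose (n : ℕ) {m : ℕ} (A : Matrix (Fin m) (Fin m) ℂ) :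
    kroneckerPow n Aᴴ = (kroneckerPow n A)ᴴ := by
  ext f g
  simp [kroneckerPow, Matrix.conjTranspose_apply]

/-- `A^{⊗ n}` as an operator on `(ℂ^m)^{⊗ n}`. -/
def photonTensorMap (n : ℕ) {m : ℕ} (A : Matrix (Fin m) (Fin m) ℂ) :
    PhotonTensor n m →L[ℂ] PhotonTensor n m :=
  Matrix.toEuclideanCLM (n := Fin n → Fin m) (𝕜 := ℂ) (kroneckerPow n A)

theorem photonTensorMap_apply (n : ℕ) {m : ℕ} (A : Matrix (Fin m) (Fin m) ℂ)
    (ψ : PhotonTensor n m) (f : Fin n → Fin m) :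
    photonTensorMap n A ψ f = ∑ g, (∏ i, A (f i) (g i)) * ψ g := rfl

theorem photonTensorMap_mem (n : ℕ) {m : ℕ} (A : Matrix (Fin m) (Fin m) ℂ) :
    ∀ ψ ∈ fockSpace n m, photonTensorMap n A ψ ∈ fockSpace n m := by
  intro ψ hψ σ f
  rw [photonTensorMap_apply, photonTensorMap_apply]
  refine (Fintype.sum_equiv (σ.arrowCongr (Equiv.refl (Fin m))) _ _ ?_)
  intro g
  have h1 : (σ.arrowCongr (Equiv.refl (Fin m))) g = g ∘ σ.symm := rfl
  rw [h1, hψ σ.symm g]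
  congr 1
  exact Fintype.prod_equiv σ _ _ fun i => by simp

/-- The restriction of `A^{⊗ n}` to the space of `n` photons in `m` modes. -/
def fockMap (n : ℕ) {m : ℕ} (A : Matrix (Fin m) (Fin m) ℂ) :
    OperatorOn (fockSpace n m) :=
  (photonTensorMap n A).restrict (photonTensorMap_mem n A)

theorem fockMap_coe (n : ℕ) {m : ℕ} (A : Matrix (Fin m) (Fin m) ℂ) (ψ : fockSpace n m) :
    (fockMap n A ψ : PhotonTensor n m) = photonTensorMap n A ψ := rfl

theorem fockMap_one (n m : ℕ) : fockMap n (1 : Matrix (Fin m) (Fin m) ℂ) = 1 := by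
  ext1 ψ
  apply Subtype.ext
  rw [fockMap_coe, photonTensorMap, kroneckerPow_one, map_one]
  rfl

theorem fockMap_mul (n : ℕ) {m : ℕ} (A B : Matrix (Fin m) (Fin m) ℂ) :
    fockMap n (A * B) = fockMap n A * fockMap n B := by
  ext1 ψ
  apply Subtype.ext
  rw [fockMap_coe, photonTensorMap, kroneckerPow_mul, map_mul]
  rfl

theorem fockMap_star (n : ℕ) {m : ℕ} (A : Matrix (Fin m) (Fin m) ℂ) :
    star (fockMap n A) = fockMap n (star A) := by
  rw [ContinuousLinearMap.star_eq_adjoint]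
  symm
  rw [ContinuousLinearMap.eq_adjoint_iff]
  intro x y
  rw [Submodule.coe_inner, Submodule.coe_inner, fockMap_coe, fockMap_coe, photonTensorMap,
    Matrix.star_eq_conjTranspose, kroneckerPow_conjTranspose, ← Matrix.star_eq_conjTranspose,
    map_star, ContinuousLinearMap.star_eq_adjoint, ContinuousLinearMap.adjoint_inner_left]
  rfl

/-- The homomorphism `U(m) → U(H)`, `U ↦ U^{⊗ n}`, where `H` is the space of `n` photons in `m`
modes. -/
def linearOpticalHom (n m : ℕ) :
    Matrix.unitaryGroup (Fin m) ℂ →* UnitaryOn (fockSpace n m) where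
  toFun U := ⟨fockMap n (U : Matrix (Fin m) (Fin m) ℂ), by
    rw [Unitary.mem_iff, fockMap_star, ← fockMap_mul, ← fockMap_mul,
      (Unitary.mem_iff.mp U.2).1, (Unitary.mem_iff.mp U.2).2]
    exact ⟨fockMap_one n m, fockMap_one n m⟩⟩
  map_one' := Subtype.ext (fockMap_one n m)
  map_mul' U W := Subtype.ext (fockMap_mul n (U : Matrix (Fin m) (Fin m) ℂ) W)

theorem isCompact_unitaryGroup (m : ℕ) :
    IsCompact (Matrix.unitaryGroup (Fin m) ℂ : Set (Matrix (Fin m) (Fin m) ℂ)) := by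
  have hc : IsCompact (Set.univ.pi fun _ : Fin m => Set.univ.pi fun _ : Fin m =>
      Metric.closedBall (0 : ℂ) 1) :=
    isCompact_univ_pi fun _ => isCompact_univ_pi fun _ => isCompact_closedBall _ _
  have hcl : IsClosed (Matrix.unitaryGroup (Fin m) ℂ : Set (Matrix (Fin m) (Fin m) ℂ)) :=
    isClosed_unitary (R := Matrix (Fin m) (Fin m) ℂ)
  refine hc.of_isClosed_subset hcl ?_
  intro U hU i _ j _
  simpa using entry_norm_bound_of_unitary hU i j

theorem continuous_linearOpticalHom (n m : ℕ) : Continuous (linearOpticalHom n m) := by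
  refine Continuous.subtype_mk ?_ _
  rw [continuous_clm_apply]
  intro ψ
  refine Continuous.subtype_mk ?_ _
  change Continuous fun U : Matrix.unitaryGroup (Fin m) ℂ =>
    photonTensorMap n (U : Matrix (Fin m) (Fin m) ℂ) (ψ : PhotonTensor n m)
  refine (PiLp.continuous_toLp 2 _).comp (continuous_pi fun f => ?_)
  change Continuous fun U : Matrix.unitaryGroup (Fin m) ℂ =>
    ∑ g, (∏ i, (U : Matrix (Fin m) (Fin m) ℂ) (f i) (g i)) * (ψ : PhotonTensor n m) g
  have h : ∀ a b, Continuous fun U : Matrix.unitaryGroup (Fin m) ℂ =>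
      (U : Matrix (Fin m) (Fin m) ℂ) a b := fun a b =>
    continuous_subtype_val.matrix_elem a b
  exact continuous_finsetSum _ fun g _ =>
    (continuous_finsetProd _ fun i _ => h _ _).mul continuous_const

/-- The group `U_{n,m}` of linear optical unitaries for `n` photons in `m` modes: the image of
`U(m)` in `U(H)`. -/
def linearOptical (n m : ℕ) : ClosedSubgroup (UnitaryOn (fockSpace n m)) where
  toSubgroup := (linearOpticalHom n m).range
  isClosed' := by
    have : CompactSpace (Matrix.unitaryGroup (Fin m) ℂ) :=
      isCompact_iff_compactSpace.mp (isCompact_unitaryGroup m)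
    exact (isCompact_range (continuous_linearOpticalHom n m)).isClosed

end

/-! The self-adjoint generators of a closed subgroup G form a real subspace 𝔤, its Lie algebra up to
a factor i; sums stay in 𝔤 by the Lie product formula, and G acts on 𝔤 by conjugation. If 𝔤 is not
everything, some nonzero self-adjoint B is orthogonal to 𝔤 for the trace form. Let S in 𝔤 be
non-scalar, such as the photon number of one mode. Then F(U) = tr(U†BUS) is real and vanishes on G.
As F² is a linear functional of (U†⊗U†)(B⊗B)(U⊗U), the design property gives ∫F² = 0 over the whole
unitary group, so F = 0 everywhere (`opTrace_conj_eq_zero_of_isGroupDesign`). Unitaries matching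
eigenbases of S and B in every order then make B a scalar, and tr B = 0 because 𝔤 contains 1; hence
B = 0, a contradiction (`eq_zero_of_forall_opTrace_conj_eq_zero`). So 𝔤 is everything, and G is the
whole group since every unitary is an exponential (`mem_of_selfAdjointGenerators_eq_top`).

Linear optics contains the global phases, so if universal it would be all of U(H)
(`mem_of_isUniversal`). But it sends v₀⊗⋯⊗v₀ to product vectors only, whereas U(H) is transitive on
unit vectors and the state with one excited photon is not a product (`exists_notMem_linearOptical`).
The same missing unitary excludes t-designs for t ≥ 2. -/

noncomputable section

/-! ### One-parameter subgroups and the Lie algebra of a closed unitary group. -/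

section OneParameterGroups

variable {A : Type*} [CStarAlgebra A]

open selfAdjoint Filter Topology

theorem Unitary.dist_mul_mul_le (a b c d : unitary A) :
    dist (a * b) (c * d) ≤ dist a c + dist b d := by
  have h1 : dist (a * b) (c * b) = dist a c := by
    rw [Subtype.dist_eq, Subtype.dist_eq, dist_eq_norm, dist_eq_norm]
    simp [← sub_mul]
  have h2 : dist (c * b) (c * d) = dist b d := by
    rw [Subtype.dist_eq, Subtype.dist_eq, dist_eq_norm, dist_eq_norm]
    simp [← mul_sub]
  calc dist (a * b) (c * d) ≤ dist (a * b) (c * b) + dist (c * b) (c * d) := dist_triangle _ _ _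
    _ = _ := by rw [h1, h2]

/-- Multiplication by a unitary is isometric, so errors only add up. The factor `k` is affordable in
the Lie product formula, where the bases differ by o(1/k). -/
theorem Unitary.dist_pow_pow_le (a b : unitary A) (k : ℕ) :
    dist (a ^ k) (b ^ k) ≤ k * dist a b := by
  induction k with
  | zero => simp
  | succ k ih =>
    rw [pow_succ, pow_succ]
    refine (Unitary.dist_mul_mul_le _ _ _ _).trans ?_
    push_cast
    linarith

theorem expUnitary_nsmul (S : selfAdjoint A) (k : ℕ) :
    expUnitary (k • S) = expUnitary S ^ k := by
  induction k with
  | zero => simp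
  | succ k ih =>
    rw [succ_nsmul, pow_succ, ← ih]
    refine Commute.expUnitary_add ?_
    simp only [AddSubgroup.coe_nsmul]
    exact (Commute.refl _).smul_left k

theorem hasDerivAt_expUnitary_smul (S : selfAdjoint A) :
    HasDerivAt (fun s : ℝ => (expUnitary (s • S) : A)) (Complex.I • (S : A)) 0 := by
  have h := hasDerivAt_exp_smul_const (𝕂 := ℝ) (Complex.I • (S : A)) 0
  simp only [zero_smul, NormedSpace.exp_zero, one_mul] at h
  refine h.congr_of_eventuallyEq (Eventually.of_forall fun s => ?_)
  simp only [selfAdjoint.expUnitary_coe, selfAdjoint.val_smul]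
  rw [smul_comm]

/-- The Lie product formula for unitary one-parameter groups. -/
theorem tendsto_expUnitary_mul_pow (S T : selfAdjoint A) :
    Tendsto (fun k : ℕ => (expUnitary ((k : ℝ)⁻¹ • S) * expUnitary ((k : ℝ)⁻¹ • T)) ^ k) atTop
      (𝓝 (expUnitary (S + T))) := by
  -- Both curves have derivative i(S + T) at 0, so they agree to first order.
  have hd : HasDerivAt (fun s : ℝ => (expUnitary (s • S) : A) * expUnitary (s • T) -
      expUnitary (s • (S + T))) 0 0 := by
    have h := ((hasDerivAt_expUnitary_smul S).mul (hasDerivAt_expUnitary_smul T)).sub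
      (hasDerivAt_expUnitary_smul (S + T))
    refine h.congr_deriv ?_
    simp
  have hlim : Tendsto (fun k : ℕ => (k : ℝ)⁻¹) atTop (𝓝[≠] 0) :=
    tendsto_nhdsWithin_iff.mpr ⟨tendsto_inv_atTop_nhds_zero_nat, by
      filter_upwards [eventually_gt_atTop 0] with k hk
      simp; omega⟩
  have h0 := (hasDerivAt_iff_tendsto_slope_zero.mp hd).comp hlim
  rw [tendsto_zero_iff_norm_tendsto_zero] at h0
  rw [tendsto_iff_dist_tendsto_zero]
  refine squeeze_zero' (Eventually.of_forall fun _ => dist_nonneg) ?_ h0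
  filter_upwards [eventually_gt_atTop 0] with k hk
  have hk' : (k : ℝ) ≠ 0 := by positivity
  have h1 : expUnitary (S + T) = expUnitary ((k : ℝ)⁻¹ • (S + T)) ^ k := by
    rw [← expUnitary_nsmul, ← Nat.cast_smul_eq_nsmul ℝ, smul_smul, mul_inv_cancel₀ hk', one_smul]
  rw [h1]
  refine (Unitary.dist_pow_pow_le _ _ _).trans ?_
  rw [Subtype.dist_eq, dist_eq_norm]
  simp [norm_smul]

/-- The self-adjoint generators of the one-parameter subgroups of a closed subgroup of the unitary
group; up to a factor `i` this is its Lie algebra. -/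
def selfAdjointGenerators (G : ClosedSubgroup (unitary A)) : Submodule ℝ (selfAdjoint A) where
  carrier := {S | ∀ s : ℝ, expUnitary (s • S) ∈ G}
  zero_mem' := by
    intro s
    simp
  smul_mem' := by
    intro c S hS s
    rw [smul_smul]
    exact hS _
  add_mem' := by
    intro S T hS hT s
    rw [smul_add]
    refine G.isClosed'.mem_of_tendsto (tendsto_expUnitary_mul_pow (s • S) (s • T))
      (Eventually.of_forall fun k => ?_)
    refine G.toSubgroup.pow_mem (G.toSubgroup.mul_mem ?_ ?_) k
    · rw [smul_smul]
      exact hS _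
    · rw [smul_smul]
      exact hT _

/-- Conjugation of a self-adjoint element by a unitary one. -/
def unitaryConj (U : unitary A) (S : selfAdjoint A) : selfAdjoint A :=
  ⟨U * S * star (U : A), S.2.conjugate _⟩

theorem expUnitary_unitaryConj (U : unitary A) (S : selfAdjoint A) :
    expUnitary (unitaryConj U S) = U * expUnitary S * U⁻¹ := by
  let _ : NormedAlgebra ℚ A := NormedAlgebra.restrictScalars ℚ ℂ A
  apply Subtype.ext
  have h := NormedSpace.exp_units_conj (Unitary.toUnits U) (Complex.I • (S : A))
  rw [mul_smul_comm, smul_mul_assoc] at h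
  simp only [selfAdjoint.expUnitary_coe, unitaryConj]
  exact h

theorem unitaryConj_mem_selfAdjointGenerators {G : ClosedSubgroup (unitary A)}
    {S : selfAdjoint A} (hS : S ∈ selfAdjointGenerators G) {U : unitary A}
    (hU : U ∈ G) : unitaryConj U S ∈ selfAdjointGenerators G := by
  intro s
  have h : s • unitaryConj U S = unitaryConj U (s • S) := by
    apply Subtype.ext
    simp [unitaryConj]
  rw [h, expUnitary_unitaryConj]
  exact G.toSubgroup.mul_mem (G.toSubgroup.mul_mem hU (hS s)) (G.toSubgroup.inv_mem hU)

/-- A closed subgroup of the unitary group whose Lie algebra is everything contains the unitaries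
of finite spectrum. -/
theorem mem_of_selfAdjointGenerators_eq_top {G : ClosedSubgroup (unitary A)}
    (hG : selfAdjointGenerators G = ⊤) (U : unitary A) (hfin : (spectrum ℂ (U : A)).Finite) :
    U ∈ G := by
  have hexp : ∀ S, expUnitary S ∈ G := fun S => by
    have : S ∈ selfAdjointGenerators G := hG ▸ Submodule.mem_top
    simpa using this 1
  let S : selfAdjoint A := Unitary.argSelfAdjoint U
  have hS : expUnitary S = U := by
    ext
    -- `Complex.arg` jumps on the negative axis, but on a finite set every function is continuous.
    have : ContinuousOn Complex.arg (spectrum ℂ (U : A)) := hfin.continuousOn _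
    rw [expUnitary_coe, Unitary.argSelfAdjoint_coe, ← CFC.exp_eq_normedSpace_exp (𝕜 := ℂ),
      ← cfc_comp_smul .., ← cfc_comp' ..]
    conv_rhs => rw [← cfc_id' ℂ (U : A)]
    refine cfc_congr fun y hy => ?_
    have hy₁ : ‖y‖ = 1 := spectrum.norm_eq_one_of_unitary U.2 hy
    have : Complex.I * y.arg = Complex.log y :=
      Complex.ext (by simp [Complex.log_re, hy₁]) (by simp [Complex.log_im])
    simpa [← Complex.exp_eq_exp_ℂ, this] using Complex.exp_log (by aesop)
  exact hS ▸ hexp S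

end OneParameterGroups

theorem ContinuousLinearMap.finite_spectrum {V : Type*} [NormedAddCommGroup V]
    [NormedSpace ℂ V] [FiniteDimensional ℂ V] (T : V →L[ℂ] V) : (spectrum ℂ T).Finite := by
  refine (Module.End.finite_spectrum (T : V →ₗ[ℂ] V)).subset ?_
  intro z hz
  contrapose! hz
  rw [spectrum.notMem_iff] at hz ⊢
  exact hz.map (Module.End.toContinuousLinearMap V)

/-! ### Traces and Haar integrals over designs. -/

section DesignIntegrals

variable {V : Type*} [NormedAddCommGroup V] [InnerProductSpace ℂ V]

/-- The trace of an operator on a finite-dimensional space. -/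
def opTrace : (OperatorOn V) →ₗ[ℂ] ℂ :=
  LinearMap.trace ℂ V ∘ₗ ContinuousLinearMap.coeLM ℂ

theorem opTrace_eq_sum_inner {ι : Type*} [Fintype ι] (b : OrthonormalBasis ι ℂ V)
    (T : OperatorOn V) : opTrace T = ∑ i, inner ℂ (b i) (T (b i)) :=
  LinearMap.trace_eq_sum_inner (T : V →ₗ[ℂ] V) b

theorem opTrace_mul_comm (S T : OperatorOn V) : opTrace (S * T) = opTrace (T * S) :=
  LinearMap.trace_mul_comm ℂ (S : V →ₗ[ℂ] V) (T : V →ₗ[ℂ] V)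

variable [FiniteDimensional ℂ V]

theorem opTrace_one : opTrace (1 : OperatorOn V) = Module.finrank ℂ V :=
  LinearMap.trace_one ℂ V

theorem continuous_opTrace : Continuous (opTrace : OperatorOn V → ℂ) :=
  LinearMap.continuous_of_finiteDimensional _

theorem opTrace_star [CompleteSpace V] (T : OperatorOn V) :
    opTrace (star T) = star (opTrace T) := by
  let b := stdOrthonormalBasis ℂ V
  rw [opTrace_eq_sum_inner b, opTrace_eq_sum_inner b, star_sum]
  refine Finset.sum_congr rfl fun i _ => ?_
  rw [ContinuousLinearMap.star_eq_adjoint, ContinuousLinearMap.adjoint_inner_right]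
  exact (inner_conj_symm _ _).symm

theorem opTrace_mul_im [CompleteSpace V] (S T : selfAdjoint (OperatorOn V)) :
    (opTrace ((S : OperatorOn V) * (T : OperatorOn V))).im = 0 := by
  have h := opTrace_star ((S : OperatorOn V) * (T : OperatorOn V))
  rw [star_mul, S.2.star_eq, T.2.star_eq, opTrace_mul_comm] at h
  exact Complex.conj_eq_iff_im.mp h.symm

theorem opTrace_star_mul_self_eq_zero [CompleteSpace V] {T : OperatorOn V}
    (h : opTrace (star T * T) = 0) : T = 0 := by
  let b := stdOrthonormalBasis ℂ V
  have h1 : opTrace (star T * T) = ((∑ i, ‖T (b i)‖ ^ 2 : ℝ) : ℂ) := by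
    rw [opTrace_eq_sum_inner b, Complex.ofReal_sum]
    refine Finset.sum_congr rfl fun i _ => ?_
    rw [mul_apply_eq_comp, ContinuousLinearMap.star_eq_adjoint,
      ContinuousLinearMap.adjoint_inner_right, inner_self_eq_norm_sq_to_K]
    simp
  rw [h1, Complex.ofReal_eq_zero, Finset.sum_eq_zero_iff_of_nonneg fun _ _ => by positivity] at h
  have h2 : (T : V →ₗ[ℂ] V) = 0 := b.toBasis.ext fun i => by
    simpa using h i (Finset.mem_univ i)
  ext x
  exact LinearMap.congr_fun h2 x

/-- The functional `⨂ C k ↦ ∏ tr (C k * A k)` on operators on a tensor power. -/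
def tensorTrace {t : ℕ} (A : Fin t → OperatorOn V) :
    Module.Dual ℂ (Module.End ℂ (⨂[ℂ] _ : Fin t, V)) :=
  let b := stdOrthonormalBasis ℂ V
  ∑ p : Fin t → Fin (Module.finrank ℂ V),
    PiTensorProduct.lift ((MultilinearMap.mkPiAlgebra ℂ (Fin t) ℂ).compLinearMap
      fun k => (innerSL ℂ (b (p k)) : V →ₗ[ℂ] ℂ)) ∘ₗ
      LinearMap.applyₗ (PiTensorProduct.tprod ℂ fun k => A k (b (p k)))

theorem tensorTrace_map {t : ℕ} (A C : Fin t → OperatorOn V) :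
    tensorTrace A (PiTensorProduct.map fun k => (C k : V →ₗ[ℂ] V)) =
      ∏ k, opTrace (C k * A k) := by
  simp only [opTrace_eq_sum_inner (stdOrthonormalBasis ℂ V)]
  rw [Finset.prod_univ_sum]
  simp [tensorTrace, PiTensorProduct.map_tprod, Fintype.piFinset_univ]

/-- The twirl of B₁⊗⋯⊗B_t, tested against `tensorTrace A`, turns the operator identity into one
between scalar integrals. -/
theorem integral_prod_trace_eq_of_isGroupDesign [CompleteSpace V] {t : ℕ}
    {G : ClosedSubgroup (UnitaryOn V)} (hG : IsGroupDesign t G) (A B : Fin t → OperatorOn V) :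
    ∫ U : G, ∏ k, opTrace (star ((U : UnitaryOn V) : OperatorOn V) * B k *
      ((U : UnitaryOn V) : OperatorOn V) * A k) ∂(haarProb G) =
    ∫ U : UnitaryOn V, ∏ k, opTrace (star (U : OperatorOn V) * B k * (U : OperatorOn V) * A k)
      ∂(haarProb (UnitaryOn V)) := by
  have key : ∀ U : UnitaryOn V,
      tensorTrace A (tensorPowMap t (star (U : OperatorOn V)) ∘ₗ
        (PiTensorProduct.map fun k => (B k : V →ₗ[ℂ] V)) ∘ₗ tensorPowMap t (U : OperatorOn V)) =
      ∏ k, opTrace (star (U : OperatorOn V) * B k * (U : OperatorOn V) * A k) := by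
    intro U
    rw [tensorPowMap, tensorPowMap, ← PiTensorProduct.map_comp, ← PiTensorProduct.map_comp]
    exact tensorTrace_map A fun k => star (U : OperatorOn V) * B k * (U : OperatorOn V)
  have hcont : Continuous fun U : UnitaryOn V =>
      ∏ k, opTrace (star (U : OperatorOn V) * B k * (U : OperatorOn V) * A k) := by
    refine continuous_finsetProd _ fun k _ => continuous_opTrace.comp ?_
    fun_prop
  have h := congrFun (hG (PiTensorProduct.map fun k => (B k : V →ₗ[ℂ] V))) (tensorTrace A)
  unfold twirl at h
  simp only [key] at h
  rw [integral_map (by fun_prop) hcont.aestronglyMeasurable] at h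
  exact h

theorem Fin.prod_ite_lt_two {t : ℕ} (ht : 2 ≤ t) (x y : ℂ) :
    ∏ k : Fin t, (if (k : ℕ) < 2 then x else y) = x ^ 2 * y ^ (t - 2) := by
  obtain ⟨s, rfl⟩ := Nat.exists_eq_add_of_le ht
  have hs : ∀ i : Fin s, ¬ 2 + (i : ℕ) ≤ 1 := fun i => by omega
  rw [Fin.prod_univ_add]
  simp [hs, sq]

/-- In a `t`-design with `t ≥ 2`, the orthogonality relation `tr (U† B U A) = 0` extends from the
subgroup to the whole unitary group. -/
theorem opTrace_conj_eq_zero_of_isGroupDesign [CompleteSpace V] {t : ℕ} (ht : 2 ≤ t)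
    {G : ClosedSubgroup (UnitaryOn V)} (hG : IsGroupDesign t G) (A B : selfAdjoint (OperatorOn V))
    (h : ∀ U ∈ G, opTrace (star (U : OperatorOn V) * (B : OperatorOn V) *
      (U : OperatorOn V) * (A : OperatorOn V)) = 0) (U : UnitaryOn V) :
    opTrace (star (U : OperatorOn V) * (B : OperatorOn V) *
      (U : OperatorOn V) * (A : OperatorOn V)) = 0 := by
  -- Dimension 0 is set apart so that the factor dim^(t-2) below can be cancelled.
  rcases Nat.eq_zero_or_pos (Module.finrank ℂ V) with h0 | hpos
  · have : Subsingleton V := Module.finrank_zero_iff.mp h0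
    rw [Subsingleton.elim (star (U : OperatorOn V) * (B : OperatorOn V) *
      (U : OperatorOn V) * (A : OperatorOn V)) 0, map_zero]
  let F : UnitaryOn V → ℝ := fun U =>
    (opTrace (star (U : OperatorOn V) * (B : OperatorOn V) *
      (U : OperatorOn V) * (A : OperatorOn V))).re
  have hF : ∀ U : UnitaryOn V, opTrace (star (U : OperatorOn V) * (B : OperatorOn V) *
      (U : OperatorOn V) * (A : OperatorOn V)) = (F U : ℂ) := by
    intro U
    have hB : IsSelfAdjoint (star (U : OperatorOn V) * (B : OperatorOn V) * (U : OperatorOn V)) :=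
      B.2.conjugate' _
    exact Complex.ext rfl (opTrace_mul_im ⟨_, hB⟩ A)
  have hcont : Continuous F := by
    refine Complex.continuous_re.comp (continuous_opTrace.comp ?_)
    fun_prop
  -- Two slots carry B and A; each of the other t - 2 carries identities and contributes tr 1 = dim.
  have hprod : ∀ U : UnitaryOn V, ∏ k : Fin t, opTrace (star (U : OperatorOn V) *
      (if (k : ℕ) < 2 then (B : OperatorOn V) else 1) * (U : OperatorOn V) *
      (if (k : ℕ) < 2 then (A : OperatorOn V) else 1)) =
      (F U : ℂ) ^ 2 * (Module.finrank ℂ V : ℂ) ^ (t - 2) := by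
    intro U
    rw [← Fin.prod_ite_lt_two ht]
    refine Finset.prod_congr rfl fun k _ => ?_
    split_ifs
    · exact hF U
    · simp [opTrace_one]
  have hint := integral_prod_trace_eq_of_isGroupDesign hG
    (fun k => if (k : ℕ) < 2 then (A : OperatorOn V) else 1)
    (fun k => if (k : ℕ) < 2 then (B : OperatorOn V) else 1)
  simp only [hprod] at hint
  have hFG : ∀ U : G, F U = 0 := fun U => by
    have := h U U.2
    rw [hF] at this
    exact_mod_cast this
  have hd : (Module.finrank ℂ V : ℂ) ^ (t - 2) ≠ 0 := pow_ne_zero _ (by exact_mod_cast hpos.ne')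
  simp only [hFG, integral_mul_const] at hint
  have hzero : ∫ U, F U ^ 2 ∂(haarProb (UnitaryOn V)) = 0 := by
    have h1 : ∫ U, (F U : ℂ) ^ 2 ∂(haarProb (UnitaryOn V)) = 0 := by
      simpa [hd] using hint
    have h2 : ∫ U, (F U : ℂ) ^ 2 ∂(haarProb (UnitaryOn V)) =
        ((∫ U, F U ^ 2 ∂(haarProb (UnitaryOn V)) : ℝ) : ℂ) := by
      rw [← integral_complex_ofReal]
      simp
    rw [h2] at h1
    exact_mod_cast h1
  rw [hF]
  by_contra hne
  have hne' : F U ^ 2 ≠ 0 := pow_ne_zero _ (by exact_mod_cast hne)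
  have : (haarProb (UnitaryOn V)).IsHaarMeasure := by
    unfold haarProb
    infer_instance
  -- Haar measure charges every nonempty open set, so a continuous nonnegative function with
  -- integral 0 vanishes; F² is nonnegative because F is real.
  have hpos := Continuous.integral_pos_of_hasCompactSupport_nonneg_nonzero
    (μ := haarProb (UnitaryOn V)) (hcont.pow 2) (HasCompactSupport.of_compactSpace _)
    (fun U => sq_nonneg (F U)) hne'
  exact hpos.ne' hzero

end DesignIntegrals

/-! ### Orthogonality for the trace form. -/

/-- A function whose pairing with every rearrangement of a nonconstant one vanishes is constant. -/
theorem eq_of_forall_sum_mul_perm_eq_zero {ι : Type*} [Fintype ι] [DecidableEq ι] {α β : ι → ℝ}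
    (h : ∀ σ : Equiv.Perm ι, ∑ k, α k * β (σ k) = 0) {i j : ι} (hij : α i ≠ α j) (p : ι) :
    β p = β i := by
  have hne : i ≠ j := fun e => hij (congrArg α e)
  have key : ∀ σ : Equiv.Perm ι, β (σ i) = β (σ j) := by
    intro σ
    -- Only the terms at `i` and `j` survive; they add up to (α i - α j)(β (σ i) - β (σ j)).
    have h1 : ∑ k, (α k * β (σ k) - α k * β ((σ * Equiv.swap i j) k)) = 0 := by
      rw [Finset.sum_sub_distrib, h, h, sub_zero]
    rw [Fintype.sum_eq_add i j hne] at h1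
    · simp only [Equiv.Perm.mul_apply, Equiv.swap_apply_left, Equiv.swap_apply_right] at h1
      have h2 : (α i - α j) * (β (σ i) - β (σ j)) = 0 := by linarith
      exact sub_eq_zero.mp ((mul_eq_zero.mp h2).resolve_left (sub_ne_zero.mpr hij))
    · rintro x ⟨hx, hx'⟩
      simp [Equiv.swap_apply_of_ne_of_ne hx hx']
  by_cases hp : p = i
  · rw [hp]
  · have := key (Equiv.swap j p)
    rw [Equiv.swap_apply_left, Equiv.swap_apply_of_ne_of_ne hne (Ne.symm hp)] at this
    exact this.symm

/-- With respect to a faithful functional, a proper subspace of self-adjoint elements has a nonzero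
orthogonal vector. -/
theorem exists_orthogonal_selfAdjoint {A : Type*} [CStarAlgebra A]
    [FiniteDimensional ℝ (selfAdjoint A)] (τ : A →ₗ[ℂ] ℂ)
    (hτ : ∀ S : selfAdjoint A, (τ ((S : A) * (S : A))).re = 0 → S = 0)
    {p : Submodule ℝ (selfAdjoint A)} (hp : p ≠ ⊤) :
    ∃ B : selfAdjoint A, B ≠ 0 ∧ ∀ T ∈ p, (τ ((B : A) * (T : A))).re = 0 := by
  let Ψ : selfAdjoint A →ₗ[ℝ] Module.Dual ℝ (selfAdjoint A) :=
    LinearMap.mk₂ ℝ (fun S T => (τ ((S : A) * (T : A))).re)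
      (fun S S' T => by simp [add_mul])
      (fun c S T => by
        rw [selfAdjoint.val_smul, smul_mul_assoc, ← Complex.coe_smul, map_smul]
        simp)
      (fun S T T' => by simp [mul_add])
      (fun c S T => by
        rw [selfAdjoint.val_smul, mul_smul_comm, ← Complex.coe_smul, map_smul]
        simp)
  -- A definite form is nondegenerate, so by dimension every functional, in particular one that
  -- kills `p`, is a pairing with some B.
  have hinj : Function.Injective Ψ := by
    rw [injective_iff_map_eq_zero]
    intro S hS
    exact hτ S (LinearMap.congr_fun hS S)
  have hsurj : Function.Surjective Ψ :=
    (LinearMap.injective_iff_surjective_of_finrank_eq_finrank Subspace.dual_finrank_eq.symm).mp hinj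
  obtain ⟨f, hf, hpf⟩ := Submodule.exists_le_ker_of_lt_top p (lt_top_iff_ne_top.mpr hp)
  obtain ⟨B, rfl⟩ := hsurj f
  exact ⟨B, fun h => hf (by rw [h, map_zero]), fun T hT => hpf hT⟩

theorem finiteDimensional_selfAdjoint {A : Type*} [CStarAlgebra A] [FiniteDimensional ℂ A] :
    FiniteDimensional ℝ (selfAdjoint A) := by
  have : FiniteDimensional ℝ A := FiniteDimensional.complexToReal A
  exact inferInstanceAs (FiniteDimensional ℝ (selfAdjoint.submodule ℝ A))

theorem isSymmetric_of_selfAdjoint {V : Type*} [NormedAddCommGroup V]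
    [InnerProductSpace ℂ V] [CompleteSpace V] (S : selfAdjoint (OperatorOn V)) :
    ((S : OperatorOn V) : V →ₗ[ℂ] V).IsSymmetric :=
  ContinuousLinearMap.isSelfAdjoint_iff_isSymmetric.mp S.2

section Irreducibility

variable {V : Type*} [NormedAddCommGroup V] [InnerProductSpace ℂ V] [CompleteSpace V]
  [FiniteDimensional ℂ V]

/-- Trace orthogonality of two self-adjoint operators in all relative positions forces one of them
to be a scalar. -/
theorem eq_zero_of_forall_opTrace_conj_eq_zero {S B : selfAdjoint (OperatorOn V)}
    (hS : ∀ c : ℝ, (S : OperatorOn V) ≠ c • 1) (hB : opTrace (B : OperatorOn V) = 0)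
    (h : ∀ U : UnitaryOn V, opTrace (star (U : OperatorOn V) * (B : OperatorOn V) *
      (U : OperatorOn V) * (S : OperatorOn V)) = 0) : B = 0 := by
  let a := (isSymmetric_of_selfAdjoint S).eigenvectorBasis rfl
  let b := (isSymmetric_of_selfAdjoint B).eigenvectorBasis rfl
  let α := (isSymmetric_of_selfAdjoint S).eigenvalues rfl
  let β := (isSymmetric_of_selfAdjoint B).eigenvalues rfl
  have ha : ∀ i, (S : OperatorOn V) (a i) = (α i : ℂ) • a i :=
    (isSymmetric_of_selfAdjoint S).apply_eigenvectorBasis rfl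
  have hb : ∀ i, (B : OperatorOn V) (b i) = (β i : ℂ) • b i :=
    (isSymmetric_of_selfAdjoint B).apply_eigenvectorBasis rfl
  have hzero : ∀ σ : Equiv.Perm (Fin (Module.finrank ℂ V)), ∑ k, α k * β (σ k) = 0 := by
    intro σ
    -- This unitary carries the eigenbasis of S to that of B permuted by σ, so the trace becomes ∑ α
    -- k * β (σ k).
    let U : UnitaryOn V := Unitary.linearIsometryEquiv.symm (a.equiv b σ)
    have hU : ∀ i, (U : OperatorOn V) (a i) = b (σ i) := fun i => by
      simp [U]
    have h1 := h U
    rw [opTrace_eq_sum_inner a] at h1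
    have h2 : ∀ i, inner ℂ (a i) ((star (U : OperatorOn V) * (B : OperatorOn V) *
        (U : OperatorOn V) * (S : OperatorOn V)) (a i)) = ((α i * β (σ i) : ℝ) : ℂ) := by
      intro i
      simp only [mul_apply_eq_comp]
      rw [ContinuousLinearMap.star_eq_adjoint, ContinuousLinearMap.adjoint_inner_right, ha,
        map_smul, hU, map_smul, hb, inner_smul_right, inner_smul_right,
        inner_self_eq_norm_sq_to_K]
      simp
    simp only [h2] at h1
    exact_mod_cast h1
  obtain ⟨i, j, hij⟩ : ∃ i j, α i ≠ α j := by
    by_contra! hcon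
    rcases isEmpty_or_nonempty (Fin (Module.finrank ℂ V)) with he | ⟨⟨i⟩⟩
    · refine hS 0 ?_
      have : (((S : OperatorOn V)) : V →ₗ[ℂ] V) = ((0 : ℝ) • (1 : OperatorOn V) : OperatorOn V) :=
        a.toBasis.ext fun i => isEmptyElim i
      exact ContinuousLinearMap.coe_injective this
    · refine hS (α i) ?_
      have : (((S : OperatorOn V)) : V →ₗ[ℂ] V) = (α i • (1 : OperatorOn V) : OperatorOn V) :=
        a.toBasis.ext fun j => by
          simp [ha, hcon j i]
      exact ContinuousLinearMap.coe_injective this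
  have hconst := eq_of_forall_sum_mul_perm_eq_zero hzero hij
  have htr : ∑ k, β k = 0 := by
    rw [opTrace_eq_sum_inner b] at hB
    have h2 : ∀ k, inner ℂ (b k) ((B : OperatorOn V) (b k)) = (β k : ℂ) := by
      intro k
      rw [hb, inner_smul_right, inner_self_eq_norm_sq_to_K]
      simp
    simp only [h2] at hB
    exact_mod_cast hB
  have hβi : β i = 0 := by
    simp only [hconst, Finset.sum_const, Finset.card_univ, Fintype.card_fin, nsmul_eq_mul] at htr
    refine (mul_eq_zero.mp htr).resolve_left ?_
    have := i.pos
    positivity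
  have hB0 : (((B : OperatorOn V)) : V →ₗ[ℂ] V) = (0 : OperatorOn V) :=
    b.toBasis.ext fun j => by
      simp [hb, hconst j, hβi]
  exact Subtype.ext (ContinuousLinearMap.coe_injective hB0)

end Irreducibility

/-! ### Generators, and designs that fill the unitary group. -/

section Generators

open selfAdjoint

variable {V : Type*} [NormedAddCommGroup V] [InnerProductSpace ℂ V] [CompleteSpace V]

/-- The operator `S` is self-adjoint and generates a one-parameter subgroup of `G`. -/
def IsGeneratorOf (G : ClosedSubgroup (UnitaryOn V)) (S : OperatorOn V) : Prop :=
  ∃ hS : IsSelfAdjoint S,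
    (⟨S, hS⟩ : selfAdjoint (OperatorOn V)) ∈ selfAdjointGenerators G

theorem IsGeneratorOf.mono {G H : ClosedSubgroup (UnitaryOn V)} {S : OperatorOn V} (hGH : G ≤ H)
    (h : IsGeneratorOf G S) : IsGeneratorOf H S :=
  ⟨h.1, fun s => hGH (h.2 s)⟩

theorem IsGeneratorOf.one_of_smul {G : ClosedSubgroup (UnitaryOn V)} {r : ℝ} (hr : r ≠ 0)
    (h : IsGeneratorOf G (r • 1)) : IsGeneratorOf G 1 := by
  refine ⟨IsSelfAdjoint.one _, ?_⟩
  have h2 := (selfAdjointGenerators G).smul_mem r⁻¹ h.2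
  convert h2 using 1
  refine Subtype.ext ?_
  rw [selfAdjoint.val_smul, smul_smul, inv_mul_cancel₀ hr, one_smul]

theorem isUniversal_of_forall_mem {G : Set (UnitaryOn V)} (hG : ∀ U, U ∈ G) : IsUniversal G :=
  fun W _ => Subgroup.le_topologicalClosure _ (Subgroup.subset_closure (hG W))

/-- The action of an exponential on a left eigenvector. -/
theorem apply_exp_of_forall_apply_eq_mul [FiniteDimensional ℂ V] {T : OperatorOn V}
    {l : V →ₗ[ℂ] ℂ} {c : ℂ} (hT : ∀ x, l (T x) = c * l x) (x : V) :
    l (NormedSpace.exp T x) = Complex.exp c * l x := by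
  have hpow : ∀ k : ℕ, l ((T ^ k) x) = c ^ k * l x := by
    intro k
    induction k with
    | zero => simp
    | succ k ih =>
      rw [pow_succ', mul_apply_eq_comp, hT, ih]
      ring
  -- Evaluation R ↦ l (R x) is linear and continuous, hence applies termwise to the exponential
  -- series.
  let L : OperatorOn V →ₗ[ℂ] ℂ :=
    l ∘ₗ LinearMap.applyₗ x ∘ₗ ContinuousLinearMap.coeLM ℂ
  have hL : Continuous L := LinearMap.continuous_of_finiteDimensional L
  have h1 := (NormedSpace.exp_series_hasSum_exp' (𝕂 := ℂ) T).map L hL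
  have h2 := (NormedSpace.exp_series_hasSum_exp' (𝕂 := ℂ) c).mul_right (l x)
  rw [← Complex.exp_eq_exp_ℂ] at h2
  have h3 : (L ∘ fun k : ℕ => ((k.factorial : ℂ)⁻¹ • T ^ k)) =
      fun k : ℕ => ((k.factorial : ℂ)⁻¹ • c ^ k) * l x := by
    funext k
    simp only [Function.comp_apply, map_smul, smul_eq_mul]
    change _ * l ((T ^ k) x) = _
    rw [hpow, mul_assoc]
  rw [h3] at h1
  exact h1.unique h2

/-- A self-adjoint operator that is diagonal in some coordinates generates a one-parameter subgroup
of `G` if `G` contains the unitaries with the corresponding phases in these coordinates. -/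
theorem IsGeneratorOf.of_diagonal [FiniteDimensional ℂ V] {G : ClosedSubgroup (UnitaryOn V)}
    {S : OperatorOn V} (hS : IsSelfAdjoint S) {ι : Type*} {l : ι → V →ₗ[ℂ] ℂ}
    (hl : ∀ x y, (∀ i, l i x = l i y) → x = y) {c : ι → ℝ} (hc : ∀ i x, l i (S x) = c i * l i x)
    (hG : ∀ s : ℝ, ∃ U ∈ G, ∀ i x,
      l i ((U : OperatorOn V) x) = Complex.exp (Complex.I * (s * c i : ℝ)) * l i x) :
    IsGeneratorOf G S := by
  refine ⟨hS, fun s => ?_⟩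
  obtain ⟨U, hU, hUl⟩ := hG s
  convert hU
  refine Subtype.ext ?_
  rw [selfAdjoint.expUnitary_coe, selfAdjoint.val_smul]
  ext1 x
  refine hl _ _ fun i => ?_
  rw [hUl, apply_exp_of_forall_apply_eq_mul]
  intro y
  rw [← Complex.coe_smul, smul_smul]
  simp only [_root_.smul_apply, map_smul, smul_eq_mul, hc]
  push_cast
  ring

/-- A closed subgroup of `U(V)` that is a `t`-design for some `t ≥ 2`, contains the phases and a
one-parameter subgroup that does not consist of phases is `U(V)`. -/
theorem mem_of_isGroupDesign [FiniteDimensional ℂ V] {t : ℕ} (ht : 2 ≤ t)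
    {G : ClosedSubgroup (UnitaryOn V)} (hG : IsGroupDesign t G) (h1 : IsGeneratorOf G 1)
    {S : OperatorOn V} (hSG : IsGeneratorOf G S)
    (hS : ∀ c : ℝ, S ≠ c • 1) (U : UnitaryOn V) : U ∈ G := by
  refine mem_of_selfAdjointGenerators_eq_top ?_ U (ContinuousLinearMap.finite_spectrum _)
  by_contra hne
  have : FiniteDimensional ℝ (selfAdjoint (OperatorOn V)) := finiteDimensional_selfAdjoint
  obtain ⟨B, hB0, hB⟩ := exists_orthogonal_selfAdjoint (opTrace (V := V)) (fun S h => by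
    refine Subtype.ext (opTrace_star_mul_self_eq_zero ?_)
    rw [S.2.star_eq]
    exact Complex.ext h (opTrace_mul_im S S)) hne
  have hB' : ∀ T ∈ selfAdjointGenerators G, opTrace ((B : OperatorOn V) * (T : OperatorOn V)) = 0 :=
    fun T hT => Complex.ext (hB T hT) (opTrace_mul_im B T)
  refine hB0 (eq_zero_of_forall_opTrace_conj_eq_zero (S := ⟨S, hSG.1⟩) hS
    (by simpa using hB' _ h1.2)
    (opTrace_conj_eq_zero_of_isGroupDesign ht hG ⟨S, hSG.1⟩ B fun U hU => ?_))
  -- By cyclicity tr(U†BUS) = tr(B · USU†), and USU† is again a generator.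
  have h2 := hB' _ (unitaryConj_mem_selfAdjointGenerators hSG.2 hU)
  rw [mul_assoc, mul_assoc, opTrace_mul_comm, mul_assoc]
  exact h2

end Generators

/-! ### Universality and global phases. -/

section Universality

open selfAdjoint

variable {V : Type*} [NormedAddCommGroup V] [InnerProductSpace ℂ V] [CompleteSpace V]
  [FiniteDimensional ℂ V]

theorem UnitaryOn.norm_det (U : UnitaryOn V) :
    ‖LinearMap.det ((U : OperatorOn V) : V →ₗ[ℂ] V)‖ = 1 := by
  rw [← LinearMap.normDet_eq_norm_det]
  exact (Unitary.linearIsometryEquiv U).toLinearIsometry.normDet_eq_one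

/-- A universal closed subgroup of `U(V)` that contains the phases is `U(V)`. -/
theorem mem_of_isUniversal {G : ClosedSubgroup (UnitaryOn V)}
    (hG : IsUniversal (G : Set (UnitaryOn V)))
    (h1 : IsGeneratorOf G 1) (U : UnitaryOn V) :
    U ∈ G := by
  rcases Nat.eq_zero_or_pos (Module.finrank ℂ V) with h0 | hpos
  · have : Subsingleton V := Module.finrank_zero_iff.mp h0
    have hU : U = 1 := Subtype.ext (Subsingleton.elim _ _)
    rw [hU]
    exact G.toSubgroup.one_mem
  -- With c^dim = det U, the operator c⁻¹U has determinant 1, and |c| = 1 makes c a phase available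
  -- in G.
  obtain ⟨c, hc⟩ := IsAlgClosed.exists_pow_nat_eq
    (LinearMap.det ((U : OperatorOn V) : V →ₗ[ℂ] V)) hpos
  have hcn : ‖c‖ = 1 := by
    refine (pow_eq_one_iff_of_nonneg (norm_nonneg c) hpos.ne').mp ?_
    rw [← norm_pow, hc, UnitaryOn.norm_det]
  have hc0 : c ≠ 0 := norm_ne_zero_iff.mp (hcn ▸ one_ne_zero)
  have hcoe : (expUnitary (c.arg • (1 : selfAdjoint (OperatorOn V))) : OperatorOn V) = c • 1 := by
    have h2 := NormedSpace.algebraMap_exp_comm (𝕂 := ℂ) (𝔸 := OperatorOn V) (c.arg * Complex.I)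
    rw [← Complex.exp_eq_exp_ℂ] at h2
    have h3 : Complex.exp (c.arg * Complex.I) = c := by
      simpa [hcn] using Complex.norm_mul_exp_arg_mul_I c
    rw [h3, Algebra.algebraMap_eq_smul_one, Algebra.algebraMap_eq_smul_one] at h2
    rw [expUnitary_coe, h2, selfAdjoint.val_smul, ← Complex.coe_smul, smul_smul, mul_comm]
    rfl
  have hphase : expUnitary (c.arg • (1 : selfAdjoint (OperatorOn V))) ∈ G.toSubgroup :=
    h1.2 c.arg
  set P := expUnitary (c.arg • (1 : selfAdjoint (OperatorOn V)))
  have hPU : ((P⁻¹ * U : UnitaryOn V) : OperatorOn V) = c⁻¹ • (U : OperatorOn V) := by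
    have : (U : OperatorOn V) = c • ((P⁻¹ * U : UnitaryOn V) : OperatorOn V) := by
      conv_lhs => rw [← mul_inv_cancel_left P U]
      rw [Submonoid.coe_mul, hcoe, smul_mul_assoc, one_mul]
    rw [this, smul_smul, inv_mul_cancel₀ hc0, one_smul]
  have hdet : LinearMap.det (((P⁻¹ * U : UnitaryOn V) : OperatorOn V) : V →ₗ[ℂ] V) = 1 := by
    rw [hPU, ContinuousLinearMap.toLinearMap_smul, LinearMap.det_smul, ← hc, ← mul_pow,
      inv_mul_cancel₀ hc0, one_pow]
  have hmem : P⁻¹ * U ∈ G.toSubgroup :=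
    Subgroup.topologicalClosure_minimal _ ((Subgroup.closure_le _).mpr subset_rfl) G.isClosed'
      (hG _ hdet)
  have := G.toSubgroup.mul_mem hphase hmem
  rwa [mul_inv_cancel_left] at this

end Universality

/-! ### Photon number operators and single-photon excitations. -/

section Fock

theorem fockSpace_ext {n m : ℕ} {ψ φ : fockSpace n m}
    (h : ∀ f, (ψ : PhotonTensor n m) f = (φ : PhotonTensor n m) f) : ψ = φ :=
  Subtype.ext (PiLp.ext h)

/-- The coordinate functionals of the standard basis. -/
def fockCoord (n m : ℕ) (f : Fin n → Fin m) : fockSpace n m →ₗ[ℂ] ℂ where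
  toFun ψ := (ψ : PhotonTensor n m) f
  map_add' _ _ := by simp
  map_smul' _ _ := by simp

/-- The symmetric product state `v_j ⊗ ⋯ ⊗ v_j`. -/
def pureState (n : ℕ) {m : ℕ} (j : Fin m) : fockSpace n m :=
  ⟨EuclideanSpace.single (fun _ => j) 1, by
    intro σ f
    have h : f ∘ σ = (fun _ => j) ↔ f = fun _ => j := by
      constructor
      · intro h
        funext i
        simpa using congrFun h (σ.symm i)
      · rintro rfl
        rfl
    simp [h]⟩

theorem pureState_apply (n : ℕ) {m : ℕ} (j : Fin m) (f : Fin n → Fin m) :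
    (pureState n j : PhotonTensor n m) f = if f = fun _ => j then 1 else 0 := by
  simp [pureState]

/-- The observable `∑ j, θ j * N j`, where `N j` counts the photons in mode `j`. -/
def numberOp (n : ℕ) {m : ℕ} (θ : Fin m → ℝ) : OperatorOn (fockSpace n m) :=
  LinearMap.toContinuousLinearMap
    { toFun := fun ψ => ⟨WithLp.toLp 2 fun f =>
          ((∑ k, θ (f k) : ℝ) : ℂ) * (ψ : PhotonTensor n m) f, by
        intro σ f
        change ((∑ k, θ (f (σ k)) : ℝ) : ℂ) * (ψ : PhotonTensor n m) (f ∘ σ) =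
          ((∑ k, θ (f k) : ℝ) : ℂ) * (ψ : PhotonTensor n m) f
        rw [ψ.2 σ f, Equiv.sum_comp σ fun k => θ (f k)]⟩
      map_add' := fun ψ φ => fockSpace_ext fun f => by simp [mul_add]
      map_smul' := fun c ψ => fockSpace_ext fun f => by simp [mul_left_comm] }

theorem numberOp_apply (n : ℕ) {m : ℕ} (θ : Fin m → ℝ) (ψ : fockSpace n m) (f : Fin n → Fin m) :
    (numberOp n θ ψ : PhotonTensor n m) f =
      ((∑ k, θ (f k) : ℝ) : ℂ) * (ψ : PhotonTensor n m) f := rfl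

theorem isSelfAdjoint_numberOp (n : ℕ) {m : ℕ} (θ : Fin m → ℝ) :
    IsSelfAdjoint (numberOp n θ) := by
  rw [ContinuousLinearMap.isSelfAdjoint_iff_isSymmetric]
  intro ψ φ
  change inner ℂ (numberOp n θ ψ) φ = inner ℂ ψ (numberOp n θ φ)
  rw [Submodule.coe_inner, Submodule.coe_inner, PiLp.inner_apply, PiLp.inner_apply]
  refine Finset.sum_congr rfl fun f _ => ?_
  rw [numberOp_apply, numberOp_apply]
  simp only [RCLike.inner_apply, map_mul, Complex.conj_ofReal]
  ring

theorem fockMap_diagonal_apply (n : ℕ) {m : ℕ} (d : Fin m → ℂ) (ψ : fockSpace n m)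
    (f : Fin n → Fin m) :
    (fockMap n (Matrix.diagonal d) ψ : PhotonTensor n m) f =
      (∏ k, d (f k)) * (ψ : PhotonTensor n m) f := by
  rw [fockMap_coe, photonTensorMap_apply, Finset.sum_eq_single f]
  · simp
  · intro g _ hg
    obtain ⟨i, hi⟩ := Function.ne_iff.mp hg.symm
    have h0 : ∏ k, Matrix.diagonal d (f k) (g k) = 0 :=
      Finset.prod_eq_zero (Finset.mem_univ i) (Matrix.diagonal_apply_ne d hi)
    exact mul_eq_zero_of_left h0 _
  · simp

theorem diagonal_phase_mem_unitaryGroup {m : ℕ} (θ : Fin m → ℝ) :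
    Matrix.diagonal (fun j => Complex.exp (Complex.I * θ j)) ∈ Matrix.unitaryGroup (Fin m) ℂ := by
  rw [Matrix.mem_unitaryGroup_iff, Matrix.star_eq_conjTranspose, Matrix.diagonal_conjTranspose,
    Matrix.diagonal_mul_diagonal, ← Matrix.diagonal_one]
  congr 1
  funext j
  rw [Pi.star_apply, Complex.star_def, ← Complex.exp_conj, ← Complex.exp_add]
  simp

theorem isGeneratorOf_numberOp (n : ℕ) {m : ℕ} (θ : Fin m → ℝ) :
    IsGeneratorOf (linearOptical n m) (numberOp n θ) := by
  refine IsGeneratorOf.of_diagonal (isSelfAdjoint_numberOp n θ) (l := fockCoord n m)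
    (fun _ _ => fockSpace_ext) (fun f ψ => numberOp_apply n θ ψ f) fun s =>
    ⟨linearOpticalHom n m ⟨_, diagonal_phase_mem_unitaryGroup (s • θ)⟩, ⟨_, rfl⟩, fun f ψ => ?_⟩
  refine (fockMap_diagonal_apply n _ ψ f).trans ?_
  rw [← Complex.exp_sum]
  change _ = _ * (ψ : PhotonTensor n m) f
  simp [Finset.mul_sum]

/-- The total photon number is the scalar n, so equal phase shifts in all modes give every global
phase once n ≠ 0. -/
theorem isGeneratorOf_one {n : ℕ} (m : ℕ) (hn : n ≠ 0) :
    IsGeneratorOf (linearOptical n m) 1 := by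
  refine IsGeneratorOf.one_of_smul (r := n) (Nat.cast_ne_zero.mpr hn) ?_
  convert isGeneratorOf_numberOp n fun _ : Fin m => (1 : ℝ)
  ext1 ψ
  refine fockSpace_ext fun f => ?_
  simp [numberOp_apply]

/-- The states with all photons in mode `i` and all in mode `j` have different eigenvalues, n and 0.
-/
theorem numberOp_single_ne_smul_one {n m : ℕ} (hn : n ≠ 0) {i j : Fin m} (hij : i ≠ j) (c : ℝ) :
    numberOp n (Pi.single i 1) ≠ c • (1 : OperatorOn (fockSpace n m)) := by
  intro h
  have h1 : ∀ l : Fin m, ((∑ _k : Fin n, (Pi.single i 1 : Fin m → ℝ) l : ℝ) : ℂ) = c := fun l => by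
    have := congrArg (fun T : OperatorOn (fockSpace n m) =>
      (T (pureState n l) : PhotonTensor n m) fun _ => l) h
    simpa [numberOp_apply, pureState_apply] using this
  have h2 := (h1 i).trans (h1 j).symm
  simp [Pi.single_eq_of_ne hij.symm, hn] at h2

/-- The unnormalized state with one photon in mode `1` and the others in mode `0`. -/
def singleExcitation (n m : ℕ) : fockSpace n m :=
  ⟨WithLp.toLp 2 fun f => if ∑ k, (f k : ℕ) = 1 then 1 else 0, by
    intro σ f
    change (if ∑ k, (f (σ k) : ℕ) = 1 then (1 : ℂ) else 0) = if ∑ k, (f k : ℕ) = 1 then 1 else 0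
    rw [Equiv.sum_comp σ fun k => (f k : ℕ)]⟩

theorem singleExcitation_apply (n m : ℕ) (f : Fin n → Fin m) :
    (singleExcitation n m : PhotonTensor n m) f = if ∑ k, (f k : ℕ) = 1 then 1 else 0 := rfl

/-- Linear optics does not turn a product state into a state with a single excited photon. -/
theorem fockMap_pureState_ne_smul_singleExcitation {n m : ℕ} (hn : 2 ≤ n) (hm : 2 ≤ m)
    (A : Matrix (Fin m) (Fin m) ℂ) {c : ℂ} (hc : c ≠ 0) :
    fockMap n A (pureState n ⟨0, by omega⟩) ≠ c • singleExcitation n m := by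
  intro h
  have hcoord : ∀ f : Fin n → Fin m,
      ∏ k, A (f k) ⟨0, by omega⟩ = c * if ∑ k, (f k : ℕ) = 1 then 1 else 0 := by
    intro f
    have h1 := congrArg (fun ψ : fockSpace n m => (ψ : PhotonTensor n m) f) h
    simpa [fockMap_coe, photonTensorMap_apply, pureState_apply, singleExcitation_apply] using h1
  -- With no photon excited the target coordinate is 0, so the n-th power of the (0,0) entry
  -- vanishes.
  have h0 : A ⟨0, by omega⟩ ⟨0, by omega⟩ = 0 := by
    have := hcoord fun _ => ⟨0, by omega⟩
    simp only [Finset.prod_const, Finset.sum_const_zero, zero_ne_one, if_false, mul_zero] at this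
    exact eq_zero_of_pow_eq_zero this
  let i0 : Fin n := ⟨0, by omega⟩
  let i1 : Fin n := ⟨1, by omega⟩
  -- One photon is excited here, so the coordinate is c; since n ≥ 2, slot `i1` still contributes
  -- the vanishing (0,0) entry.
  have h1 := hcoord fun k => if k = i0 then ⟨1, by omega⟩ else ⟨0, by omega⟩
  rw [Finset.prod_eq_zero (Finset.mem_univ i1) (by simp [i0, i1, h0]), if_pos, mul_one] at h1
  · exact hc h1.symm
  · simp [apply_ite]

theorem singleExcitation_ne_zero {n m : ℕ} (hn : 2 ≤ n) (hm : 2 ≤ m) :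
    singleExcitation n m ≠ 0 := by
  intro h
  let i0 : Fin n := ⟨0, by omega⟩
  have h1 := congrArg (fun ψ : fockSpace n m => (ψ : PhotonTensor n m)
    fun k => if k = i0 then ⟨1, by omega⟩ else ⟨0, by omega⟩) h
  simp [singleExcitation_apply, apply_ite] at h1

/-- The unitary group acts transitively on unit vectors. -/
theorem exists_unitary_apply_eq {V : Type*} [NormedAddCommGroup V] [InnerProductSpace ℂ V]
    [CompleteSpace V] [FiniteDimensional ℂ V] {x y : V} (hx : ‖x‖ = 1) (hy : ‖y‖ = 1) :
    ∃ U : UnitaryOn V, (U : OperatorOn V) x = y := by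
  have key : ∀ z : V, ‖z‖ = 1 → ∃ (b : OrthonormalBasis (Fin (Module.finrank ℂ V)) ℂ V) (i : _),
      b i = z := by
    intro z hz
    have hz0 : z ≠ 0 := norm_ne_zero_iff.mp (hz ▸ one_ne_zero)
    have hpos : 0 < Module.finrank ℂ V := Module.finrank_pos_iff_exists_ne_zero.mpr ⟨z, hz0⟩
    let i : Fin (Module.finrank ℂ V) := ⟨0, hpos⟩
    obtain ⟨b, hb⟩ := Orthonormal.exists_orthonormalBasis_extension_of_card_eq (𝕜 := ℂ) (E := V)
      (ι := Fin (Module.finrank ℂ V)) (by simp) (v := fun _ => z) (s := {i})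
      ⟨fun _ => hz, fun a b hab => (hab (Subsingleton.elim a b)).elim⟩
    exact ⟨b, i, hb i rfl⟩
  obtain ⟨a, i, rfl⟩ := key x hx
  obtain ⟨b, j, rfl⟩ := key y hy
  -- The swap makes the map between the bases send index `i` to index `j`.
  exact ⟨Unitary.linearIsometryEquiv.symm (a.equiv b (Equiv.swap i j)), by simp⟩

theorem exists_notMem_linearOptical {n m : ℕ} (hn : 2 ≤ n) (hm : 2 ≤ m) :
    ∃ U, U ∉ linearOptical n m := by
  have hb : ‖singleExcitation n m‖ ≠ 0 := norm_ne_zero_iff.mpr (singleExcitation_ne_zero hn hm)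
  have hp : ‖pureState n (⟨0, by omega⟩ : Fin m)‖ = 1 := by
    simp [pureState]
  obtain ⟨U, hU⟩ := exists_unitary_apply_eq hp
    (y := ((‖singleExcitation n m‖⁻¹ : ℝ) : ℂ) • singleExcitation n m) (by
      rw [norm_smul, Complex.norm_real, norm_inv, norm_norm, inv_mul_cancel₀ hb])
  refine ⟨U, ?_⟩
  rintro ⟨W, rfl⟩
  exact fockMap_pureState_ne_smul_singleExcitation hn hm _ (by simpa using hb) hU

end Fock

/-- A general G at t = 2 gives the first claim; G = `linearOptical n m` at any t ≥ 2 gives the last.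
The non-scalar generator counts photons in mode 0, and m ≥ 2 supplies a second mode. -/
theorem mem_of_isGroupDesign_of_linearOptical_le {n m t : ℕ} (hn : 2 ≤ n) (hm : 2 ≤ m)
    (ht : 2 ≤ t) {G : ClosedSubgroup (UnitaryOn (fockSpace n m))} (hle : linearOptical n m ≤ G)
    (hG : IsGroupDesign t G) (U : UnitaryOn (fockSpace n m)) : U ∈ G :=
  mem_of_isGroupDesign ht hG ((isGeneratorOf_one m (by omega)).mono hle)
    ((isGeneratorOf_numberOp n (Pi.single (⟨0, by omega⟩ : Fin m) 1)).mono hle)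
    (numberOp_single_ne_smul_one (j := ⟨1, by omega⟩) (by omega) (by simp)) U

theorem mainTheorem4 (n m : ℕ) (hn : 2 ≤ n) (hm : 2 ≤ m) :
    (∀ G : ClosedSubgroup (UnitaryOn (fockSpace n m)),
      linearOptical n m ≤ G → IsGroupDesign 2 G →
        IsUniversal (G : Set (UnitaryOn (fockSpace n m))) ∧
          (G : Set (UnitaryOn (fockSpace n m))) = Set.univ) ∧
    ¬ IsUniversal (linearOptical n m : Set (UnitaryOn (fockSpace n m))) ∧
    ∀ t : ℕ, 2 ≤ t → ¬ IsGroupDesign t (linearOptical n m) := by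
  obtain ⟨U, hU⟩ := exists_notMem_linearOptical hn hm
  refine ⟨fun G hle hG => ?_, fun h => ?_, fun t ht h => ?_⟩
  · have hall := mem_of_isGroupDesign_of_linearOptical_le hn hm le_rfl hle hG
    exact ⟨isUniversal_of_forall_mem hall, Set.eq_univ_of_forall hall⟩
  · exact hU (mem_of_isUniversal h (isGeneratorOf_one m (by omega)) U)
  · exact hU (mem_of_isGroupDesign_of_linearOptical_le hn hm ht le_rfl h U)

end
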